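/- Let $Q$ be the 3-dimensional cube graph ($8$ vertices, $12$ edges). A graph is called $Q$-free if it does not contain $Q$ as a (not necessarily induced) subgraph, and $\mathrm{ex}(n,Q)$ denotes the maximum number of edges of a $Q$-free simple graph on $n$ vertices. Then the following hold. 1. Every finite simple $Q$-free graph $G$ on $n$ vertices satisfies $e(G)\le n^{8/5}+(2n)^{3/2}$. Equivalently, $\mathrm{ex}(n,Q)\le n^{8/5}+(2n)^{3/2}$ for every $n\ge 0$. In particular, $\mathrm{ex}(n,Q)=O(n^{8/5})$ as $n\to\infty$. 2. Every finite bipartite $Q$-free graph $G$ with parts of sizes $a$ and $b$ satisfies $e(G)\le 2^{3/5}(ab)^{4/5}+2ab^{1/2}+2a^{1/2}b$. -/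

import Mathlib

/-- The cube graph `Q`: its 8 vertices are the 0-1 sequences of length 3, and two of them
are adjacent when they differ in exactly one coordinate. -/
def cubeGraph : SimpleGraph (Fin 3 → Bool) where
  Adj u v := hammingDist u v = 1
  symm := ⟨fun u v h => by rw [hammingDist_comm]; exact h⟩
  loopless := ⟨fun u h => by simp at h⟩

/-! Count walks `x u v y` of length three in a bipartite cube-free graph with `e` edges. There are
at least `e³/(|X||Y|)` of them (`card_interedges_pow_three_le`). For fixed ends `x`, `y` they are
the edges between `N(y)` and `N(x)`; after deleting `x` and `y` these span no 6-cycle, as a 6-cycle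
together with `x` and `y` forms a cube.

A hexagon-free bipartite graph is sparse (`HexagonFree.three_mul_card_interedges_le`), by the same
kind of walk count. That bound is kept linear in `mn`, `m`, `n`, with free parameters `a`, `b`, so
that it can be summed over all `(x, y)` before optimising. Comparing the two estimates of the walk
count yields the bipartite bound; a cut containing half the edges gives the general one. -/

section

open Finset

/-! ### Weighted counts of walks of length three. -/

section BipartiteRelation

open scoped Classical

variable {α β : Type*}

/-- A relation between the finite sets `X` and `Y` is hexagon-free when the bipartite graph it
defines contains no 6-cycle; `xᵢ` and `yᵢ` are opposite vertices of the 6-cycle. -/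
def HexagonFree (R : α → β → Prop) (X : Finset α) (Y : Finset β) : Prop :=
  ∀ x₁ ∈ X, ∀ x₂ ∈ X, ∀ x₃ ∈ X, ∀ y₁ ∈ Y, ∀ y₂ ∈ Y, ∀ y₃ ∈ Y,
    x₁ ≠ x₂ → x₁ ≠ x₃ → x₂ ≠ x₃ → y₁ ≠ y₂ → y₁ ≠ y₃ → y₂ ≠ y₃ →
    R x₁ y₂ → R x₁ y₃ → R x₂ y₁ → R x₂ y₃ → R x₃ y₁ → R x₃ y₂ → False

theorem HexagonFree.flip {R : α → β → Prop} {X : Finset α} {Y : Finset β}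
    (h : HexagonFree R X Y) : HexagonFree (fun y x => R x y) Y X :=
  fun y₁ m₁ y₂ m₂ y₃ m₃ x₁ n₁ x₂ n₂ x₃ n₃ a b c d e f r₁ r₂ r₃ r₄ r₅ r₆ =>
    h x₁ n₁ x₂ n₂ x₃ n₃ y₁ m₁ y₂ m₂ y₃ m₃ d e f a b c r₃ r₅ r₁ r₆ r₂ r₄

/-- AM-GM for `p²q²`, `p`, `q`. With `z = √p√q` and `p + q ≥ 2z` it reduces to `z⁴ - 3z² + 2z = z(z
- 1)²(z + 2) ≥ 0`. -/
theorem three_mul_le_sq_mul_sq_add {p q : ℝ} (hp : 0 ≤ p) (hq : 0 ≤ q) :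
    3 * (p * q) ≤ p ^ 2 * q ^ 2 + p + q := by
  obtain ⟨c, hc, rfl⟩ : ∃ c : ℝ, 0 ≤ c ∧ c ^ 2 = p := ⟨√p, Real.sqrt_nonneg _, Real.sq_sqrt hp⟩
  obtain ⟨d, hd, rfl⟩ : ∃ d : ℝ, 0 ≤ d ∧ d ^ 2 = q := ⟨√q, Real.sqrt_nonneg _, Real.sq_sqrt hq⟩
  have h : 0 ≤ (c * d) * (c * d - 1) ^ 2 * (c * d + 2) := by positivity
  nlinarith [sq_nonneg (c - d)]

/-- AM-GM applies to `fg/(ab)`, `a/f`, `b/g`, whose product is 1. Multiplying by the weight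
`(f/d)(g/e) ≤ 1` turns the denominators `f`, `g` into the degrees `d`, `e`, so the last two terms
have bounded sums over edges. -/
theorem three_mul_div_mul_div_le {f g d e a b : ℝ} (hf : 0 ≤ f) (hfd : f ≤ d) (hg : 0 ≤ g)
    (hge : g ≤ e) (hd : 0 < d) (he : 0 < e) (ha : 0 < a) (hb : 0 < b) :
    3 * ((f / d) * (g / e)) ≤ f * g / (a * b) + a / d + b / e := by
  have hs1 : f / d ≤ 1 := (div_le_one hd).2 hfd
  have ht1 : g / e ≤ 1 := (div_le_one he).2 hge
  rcases hf.eq_or_lt with rfl | hf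
  · simp only [zero_div, zero_mul, mul_zero, zero_add]; positivity
  rcases hg.eq_or_lt with rfl | hg
  · simp only [zero_div, mul_zero, zero_add]; positivity
  have key := three_mul_le_sq_mul_sq_add (p := f / a) (q := g / b) (by positivity) (by positivity)
  have key' : 3 ≤ f * g / (a * b) + a / f + b / g := by
    rw [← sub_nonneg] at key ⊢
    have : f * g / (a * b) + a / f + b / g - 3 =
        ((f / a) ^ 2 * (g / b) ^ 2 + f / a + g / b - 3 * (f / a * (g / b))) *
          (a * b / (f * g)) := by
      field_simp
      ring
    rw [this]
    positivity
  have hst : (f / d) * (g / e) ≤ 1 := mul_le_one₀ hs1 (by positivity) ht1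
  calc 3 * ((f / d) * (g / e)) ≤ (f * g / (a * b) + a / f + b / g) * ((f / d) * (g / e)) := by
        gcongr
    _ = f * g / (a * b) * ((f / d) * (g / e)) + a / d * (g / e) + b / e * (f / d) := by
        field_simp
    _ ≤ f * g / (a * b) * 1 + a / d * 1 + b / e * 1 := by gcongr
    _ = _ := by ring

theorem sum_interedges_fst (R : α → β → Prop) (X : Finset α) (Y : Finset β) (h : α → ℝ) :
    ∑ p ∈ Rel.interedges R X Y, h p.1 = ∑ x ∈ X, (#{y ∈ Y | R x y} : ℝ) * h x := by
  rw [Rel.interedges, sum_filter, sum_product]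
  refine sum_congr rfl fun x _ => ?_
  dsimp only
  rw [← sum_filter, sum_const, nsmul_eq_mul]

theorem sum_interedges_snd (R : α → β → Prop) (X : Finset α) (Y : Finset β) (h : β → ℝ) :
    ∑ p ∈ Rel.interedges R X Y, h p.2 = ∑ y ∈ Y, (#{x ∈ X | R x y} : ℝ) * h y := by
  rw [Rel.interedges, sum_filter, sum_product_right]
  refine sum_congr rfl fun x _ => ?_
  dsimp only
  rw [← sum_filter, sum_const, nsmul_eq_mul]

theorem sum_interedges_div_degree_fst_le (R : α → β → Prop) (X : Finset α) (Y : Finset β)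
    {a : ℝ} (ha : 0 ≤ a) :
    ∑ p ∈ Rel.interedges R X Y, a / (#{y ∈ Y | R p.1 y} : ℝ) ≤ a * #X := by
  rw [sum_interedges_fst R X Y (fun x => a / (#{y ∈ Y | R x y} : ℝ))]
  calc _ ≤ ∑ x ∈ X, a := sum_le_sum fun x _ => by
        rw [mul_div_left_comm]
        -- Isolated vertices contribute `0 / 0 = 0`.
        exact mul_le_of_le_one_right ha (div_self_le_one _)
    _ = _ := by rw [sum_const, nsmul_eq_mul, mul_comm]

theorem sum_interedges_div_degree_snd_le (R : α → β → Prop) (X : Finset α) (Y : Finset β)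
    {b : ℝ} (hb : 0 ≤ b) :
    ∑ p ∈ Rel.interedges R X Y, b / (#{x ∈ X | R x p.2} : ℝ) ≤ b * #Y := by
  rw [sum_interedges_snd R X Y (fun y => b / (#{x ∈ X | R x y} : ℝ))]
  calc _ ≤ ∑ y ∈ Y, b := sum_le_sum fun x _ => by
        rw [mul_div_left_comm]
        exact mul_le_of_le_one_right hb (div_self_le_one _)
    _ = _ := by rw [sum_const, nsmul_eq_mul, mul_comm]

theorem degree_pos_of_mem_interedges {R : α → β → Prop} {X : Finset α} {Y : Finset β} {p : α × β}
    (hp : p ∈ Rel.interedges R X Y) :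
    0 < (#{y ∈ Y | R p.1 y} : ℝ) ∧ 0 < (#{x ∈ X | R x p.2} : ℝ) := by
  rw [Rel.mem_interedges_iff] at hp
  exact ⟨by exact_mod_cast card_pos.2 ⟨p.2, by simp [hp]⟩,
    by exact_mod_cast card_pos.2 ⟨p.1, by simp [hp]⟩⟩

/-- A weighted form of the lower bound for the number of walks of length three. -/
theorem three_mul_sum_interedges_le (R : α → β → Prop) (X : Finset α) (Y : Finset β)
    {f : α → ℝ} {g : β → ℝ} (hf : ∀ x, 0 ≤ f x) (hg : ∀ y, 0 ≤ g y)
    (hfd : ∀ x, f x ≤ #{y ∈ Y | R x y}) (hgd : ∀ y, g y ≤ #{x ∈ X | R x y})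
    {a b : ℝ} (ha : 0 < a) (hb : 0 < b) :
    3 * ∑ p ∈ Rel.interedges R X Y,
        (f p.1 / #{y ∈ Y | R p.1 y}) * (g p.2 / #{x ∈ X | R x p.2}) ≤
      (∑ p ∈ Rel.interedges R X Y, f p.1 * g p.2) / (a * b) + a * #X + b * #Y := by
  calc _ ≤ ∑ p ∈ Rel.interedges R X Y, (f p.1 * g p.2 / (a * b)
        + a / (#{y ∈ Y | R p.1 y} : ℝ) + b / (#{x ∈ X | R x p.2} : ℝ)) := by
        rw [mul_sum]
        refine sum_le_sum fun p hp => ?_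
        have := degree_pos_of_mem_interedges hp
        exact three_mul_div_mul_div_le (hf _) (hfd _) (hg _) (hgd _) this.1 this.2 ha hb
    _ ≤ _ := by
        rw [sum_add_distrib, sum_add_distrib, ← sum_div]
        gcongr
        · exact sum_interedges_div_degree_fst_le R X Y ha.le
        · exact sum_interedges_div_degree_snd_le R X Y hb.le

/-- The number of walks of length three in a bipartite graph with `e` edges is at least
`e ^ 3 / (|X| |Y|)`. -/
theorem card_interedges_pow_three_le (R : α → β → Prop) (X : Finset α) (Y : Finset β) :
    (#(Rel.interedges R X Y) : ℝ) ^ 3 ≤ #X * #Y *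
      ∑ p ∈ Rel.interedges R X Y, (#{y ∈ Y | R p.1 y} : ℝ) * #{x ∈ X | R x p.2} := by
  rcases (Rel.interedges R X Y).eq_empty_or_nonempty with h0 | ⟨p, hp⟩
  · simp [h0]
  have hp' := (Rel.mem_interedges_iff).1 hp
  have he : 0 < (#(Rel.interedges R X Y) : ℝ) := by exact_mod_cast card_pos.2 ⟨p, hp⟩
  have hX : 0 < (#X : ℝ) := by exact_mod_cast card_pos.2 ⟨p.1, hp'.1⟩
  have hY : 0 < (#Y : ℝ) := by exact_mod_cast card_pos.2 ⟨p.2, hp'.2.1⟩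
  -- All weights are 1, and `a`, `b` are the average degrees, so the bound reads `3e ≤ W/(ab) + e +
  -- e`.
  have key := three_mul_sum_interedges_le R X Y (f := fun x => #{y ∈ Y | R x y})
    (g := fun y => #{x ∈ X | R x y}) (fun _ => by positivity) (fun _ => by positivity)
    (fun _ => le_rfl) (fun _ => le_rfl) (div_pos he hX) (div_pos he hY)
  have h1 : ∑ p ∈ Rel.interedges R X Y, ((#{y ∈ Y | R p.1 y} : ℝ) / #{y ∈ Y | R p.1 y}) *
      ((#{x ∈ X | R x p.2} : ℝ) / #{x ∈ X | R x p.2}) = #(Rel.interedges R X Y) := by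
    rw [← nsmul_one (#(Rel.interedges R X Y)), ← sum_const]
    refine sum_congr rfl fun p hp => ?_
    have := degree_pos_of_mem_interedges hp
    rw [div_self this.1.ne', div_self this.2.ne', one_mul]
  rw [h1] at key
  set W := ∑ p ∈ Rel.interedges R X Y, (#{y ∈ Y | R p.1 y} : ℝ) * #{x ∈ X | R x p.2}
  set e : ℝ := (#(Rel.interedges R X Y) : ℝ)
  have h2 : e ≤ W / (e / #X * (e / #Y)) := by
    rw [div_mul_cancel₀ _ hX.ne', div_mul_cancel₀ _ hY.ne'] at key
    linarith
  rw [le_div_iff₀ (by positivity)] at h2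
  calc e ^ 3 = #X * #Y * (e * (e / #X * (e / #Y))) := by field_simp
    _ ≤ _ := by gcongr

end BipartiteRelation

/-! ### Edge bound for hexagon-free bipartite graphs. -/

section HexagonFree

open scoped Classical

variable {α β : Type*} {R : α → β → Prop} {X : Finset α} {Y : Finset β}

/-- The 2 accounts for `v` itself and at most one bad neighbour of `u`: two bad ones `x`, `x'` would
give a 6-cycle `v y₁ x u x' y₂`. -/
theorem HexagonFree.degree_sub_two_le (h : HexagonFree R X Y) {v : α} {u : β} (hv : v ∈ X)
    (hu : u ∈ Y) :
    #{x ∈ X | R x u} - 2 ≤ #{x ∈ X | R x u ∧ x ≠ v ∧ #{y ∈ Y | R v y ∧ R x y} ≤ 2} := by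
  have hbad : #{x ∈ X | R x u ∧ x ≠ v ∧ 2 < #{y ∈ Y | R v y ∧ R x y}} ≤ 1 := by
    rw [card_le_one]
    intro x hx x' hx'
    simp only [mem_filter] at hx hx'
    by_contra hne
    obtain ⟨y₁, hy₁, hy₁'⟩ := exists_mem_notMem_of_card_lt_card
      (s := {u}) (t := {y ∈ Y | R v y ∧ R x y}) (by rw [card_singleton]; omega)
    obtain ⟨y₂, hy₂, hy₂'⟩ := exists_mem_notMem_of_card_lt_card
      (s := {u, y₁}) (t := {y ∈ Y | R v y ∧ R x' y}) (card_le_two.trans_lt hx'.2.2.2)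
    simp only [mem_filter, mem_singleton, mem_insert, not_or] at hy₁ hy₁' hy₂ hy₂'
    exact h v hv x hx.1 x' hx'.1 u hu y₂ hy₂.1 y₁ hy₁.1 (Ne.symm hx.2.2.1) (Ne.symm hx'.2.2.1)
      hne (Ne.symm hy₂'.1) (Ne.symm hy₁') hy₂'.2 hy₂.2.1 hy₁.2.1 hx.2.1 hy₁.2.2 hx'.2.1 hy₂.2.2
  have hsub : ({x ∈ X | R x u} : Finset α) ⊆
      {x ∈ X | R x u ∧ x ≠ v ∧ #{y ∈ Y | R v y ∧ R x y} ≤ 2} ∪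
        {x ∈ X | R x u ∧ x ≠ v ∧ 2 < #{y ∈ Y | R v y ∧ R x y}} ∪ {v} := by
    intro x hx
    simp only [mem_filter, mem_union, mem_singleton] at hx ⊢
    rcases eq_or_ne x v with hxv | hxv
    · exact Or.inr hxv
    · rcases le_or_gt (#{y ∈ Y | R v y ∧ R x y}) 2 with hc | hc <;> tauto
  have h1 := card_le_card hsub
  have h2 := card_union_le ({x ∈ X | R x u ∧ x ≠ v ∧ #{y ∈ Y | R v y ∧ R x y} ≤ 2} ∪
        {x ∈ X | R x u ∧ x ≠ v ∧ 2 < #{y ∈ Y | R v y ∧ R x y}}) {v}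
  have h3 := card_union_le ({x ∈ X | R x u ∧ x ≠ v ∧ #{y ∈ Y | R v y ∧ R x y} ≤ 2})
        {x ∈ X | R x u ∧ x ≠ v ∧ 2 < #{y ∈ Y | R v y ∧ R x y}}
  rw [card_singleton] at h2
  omega

/-- In a hexagon-free bipartite graph, few paths `x u v y` avoid the vertices `x` with more than
two neighbours in common with `v` and the vertices `y` with more than two neighbours in common
with `u`. -/
theorem HexagonFree.card_paths_le (h : HexagonFree R X Y) {x : α} {y : β} (hx : x ∈ X)
    (hy : y ∈ Y) :
    #{p ∈ Rel.interedges R X Y |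
      (R x p.2 ∧ x ≠ p.1 ∧ #{y ∈ Y | R p.1 y ∧ R x y} ≤ 2) ∧
      (R p.1 y ∧ y ≠ p.2 ∧ #{x ∈ X | R x p.2 ∧ R x y} ≤ 2)} ≤ 4 := by
  set P := {p ∈ Rel.interedges R X Y |
      (R x p.2 ∧ x ≠ p.1 ∧ #{y ∈ Y | R p.1 y ∧ R x y} ≤ 2) ∧
      (R p.1 y ∧ y ≠ p.2 ∧ #{x ∈ X | R x p.2 ∧ R x y} ≤ 2)} with hP
  rcases P.eq_empty_or_nonempty with h0 | ⟨q, hq⟩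
  · simp [h0]
  have hq' := hq
  rw [hP, mem_filter, Rel.mem_interedges_iff] at hq'
  obtain ⟨⟨hq1, hq2, hqR⟩, ⟨a1, a2, a3⟩, b1, b2, b3⟩ := hq'
  -- Two paths differing in both middle vertices close up to a 6-cycle through `x` and `y`. So every
  -- path shares a middle vertex with `q`, leaving at most two choices for the other one in either
  -- case.
  have hsub : P ⊆ {q.1} ×ˢ {y ∈ Y | R q.1 y ∧ R x y} ∪ {x ∈ X | R x q.2 ∧ R x y} ×ˢ {q.2} := by
    intro p hp
    rw [hP, mem_filter, Rel.mem_interedges_iff] at hp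
    obtain ⟨⟨hp1, hp2, hpR⟩, ⟨c1, c2, c3⟩, d1, d2, d3⟩ := hp
    simp only [mem_union, mem_product, mem_singleton, mem_filter]
    by_cases e1 : p.1 = q.1
    · exact Or.inl ⟨e1, hp2, e1 ▸ hpR, c1⟩
    by_cases e2 : p.2 = q.2
    · exact Or.inr ⟨⟨hp1, e2 ▸ hpR, d1⟩, e2⟩
    exact (h x hx p.1 hp1 q.1 hq1 y hy q.2 hq2 p.2 hp2 c2 a2 e1 b2 d2 (Ne.symm e2)
      a1 c1 d1 hpR b1 hqR).elim
  have h1 := card_le_card hsub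
  have h2 := card_union_le ({q.1} ×ˢ {y ∈ Y | R q.1 y ∧ R x y})
    ({x ∈ X | R x q.2 ∧ R x y} ×ˢ {q.2})
  rw [card_product, card_product, card_singleton, card_singleton] at h2
  omega

theorem HexagonFree.sum_degree_sub_two_mul_le (h : HexagonFree R X Y) :
    ∑ p ∈ Rel.interedges R X Y, (#{y ∈ Y | R p.1 y} - 2) * (#{x ∈ X | R x p.2} - 2) ≤
      4 * (#X * #Y) := by
  calc _ ≤ ∑ p ∈ Rel.interedges R X Y,
        #{y ∈ Y | R p.1 y ∧ y ≠ p.2 ∧ #{x ∈ X | R x p.2 ∧ R x y} ≤ 2} *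
        #{x ∈ X | R x p.2 ∧ x ≠ p.1 ∧ #{y ∈ Y | R p.1 y ∧ R x y} ≤ 2} := by
        refine sum_le_sum fun p hp => ?_
        rw [Rel.mem_interedges_iff] at hp
        exact Nat.mul_le_mul (h.flip.degree_sub_two_le hp.2.1 hp.1)
          (h.degree_sub_two_le hp.1 hp.2.1)
    _ = ∑ p ∈ Rel.interedges R X Y, #{q ∈ X ×ˢ Y |
          (R q.1 p.2 ∧ q.1 ≠ p.1 ∧ #{y ∈ Y | R p.1 y ∧ R q.1 y} ≤ 2) ∧
          (R p.1 q.2 ∧ q.2 ≠ p.2 ∧ #{x ∈ X | R x p.2 ∧ R x q.2} ≤ 2)} := by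
        refine sum_congr rfl fun p _ => ?_
        rw [mul_comm, ← card_product, ← filter_product]
    _ = ∑ q ∈ X ×ˢ Y, #{p ∈ Rel.interedges R X Y |
          (R q.1 p.2 ∧ q.1 ≠ p.1 ∧ #{y ∈ Y | R p.1 y ∧ R q.1 y} ≤ 2) ∧
          (R p.1 q.2 ∧ q.2 ≠ p.2 ∧ #{x ∈ X | R x p.2 ∧ R x q.2} ≤ 2)} := by
        simp only [card_filter]
        exact sum_comm
    _ ≤ ∑ q ∈ X ×ˢ Y, 4 := sum_le_sum fun q hq =>
        h.card_paths_le (mem_product.1 hq).1 (mem_product.1 hq).2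
    _ = _ := by rw [sum_const, smul_eq_mul, card_product, mul_comm]

/-- A linearised form of the bound `2 (m n) ^ (2 / 3) + 2 (m + n)` for the number of edges of a
hexagon-free bipartite graph with parts of sizes `m` and `n`. -/
theorem HexagonFree.three_mul_card_interedges_le (h : HexagonFree R X Y) {a b : ℝ} (ha : 0 < a)
    (hb : 0 < b) :
    3 * (#(Rel.interedges R X Y) : ℝ) ≤
      8 * (#X * #Y) / (a * b) + a * #X + b * #Y + 6 * (#X + #Y) := by
  have key := three_mul_sum_interedges_le R X Y (f := fun x => ((#{y ∈ Y | R x y} - 2 : ℕ) : ℝ))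
    (g := fun y => ((#{x ∈ X | R x y} - 2 : ℕ) : ℝ)) (fun _ => by positivity)
    (fun _ => by positivity) (fun _ => by exact_mod_cast Nat.sub_le _ _)
    (fun _ => by exact_mod_cast Nat.sub_le _ _) ha hb
  have h1 : (∑ p ∈ Rel.interedges R X Y, ((#{y ∈ Y | R p.1 y} - 2 : ℕ) : ℝ) *
      ((#{x ∈ X | R x p.2} - 2 : ℕ) : ℝ)) ≤ 8 * (#X * #Y) := by
    have : (∑ p ∈ Rel.interedges R X Y, ((#{y ∈ Y | R p.1 y} - 2 : ℕ) : ℝ) *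
      ((#{x ∈ X | R x p.2} - 2 : ℕ) : ℝ)) ≤ 4 * (#X * #Y) := by
      exact_mod_cast h.sum_degree_sub_two_mul_le
    -- The constant 4 is relaxed to 8, which is what leads to `2 ^ (3 / 5)` in the final bound.
    refine this.trans ?_
    gcongr
    norm_num
  have h2 : (#(Rel.interedges R X Y) : ℝ) ≤ ∑ p ∈ Rel.interedges R X Y,
      ((((#{y ∈ Y | R p.1 y} - 2 : ℕ) : ℝ) / #{y ∈ Y | R p.1 y}) *
        (((#{x ∈ X | R x p.2} - 2 : ℕ) : ℝ) / #{x ∈ X | R x p.2})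
        + 2 / (#{y ∈ Y | R p.1 y} : ℝ) + 2 / (#{x ∈ X | R x p.2} : ℝ)) := by
    rw [← nsmul_one (#(Rel.interedges R X Y)), ← sum_const]
    refine sum_le_sum fun p hp => ?_
    obtain ⟨hd, he⟩ := degree_pos_of_mem_interedges hp
    have aux (d : ℕ) (hd : 0 < (d : ℝ)) :
        1 - 2 / (d : ℝ) ≤ ((d - 2 : ℕ) : ℝ) / d ∧ ((d - 2 : ℕ) : ℝ) / d ≤ 1 := by
      constructor
      · rw [one_sub_div hd.ne']
        gcongr
        rw [sub_le_iff_le_add]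
        exact_mod_cast (by omega : d ≤ d - 2 + 2)
      · rw [div_le_one hd]
        exact_mod_cast Nat.sub_le _ _
    obtain ⟨s1, s2⟩ := aux _ hd
    obtain ⟨t1, t2⟩ := aux _ he
    -- For ratios `s, t ≤ 1`, `(1 - s)(1 - t) ≥ 0` gives `st ≥ s + t - 1`.
    nlinarith [mul_nonneg (sub_nonneg.2 s2) (sub_nonneg.2 t2)]
  rw [sum_add_distrib, sum_add_distrib] at h2
  have h3 := sum_interedges_div_degree_fst_le R X Y (a := 2) (by norm_num)
  have h4 := sum_interedges_div_degree_snd_le R X Y (b := 2) (by norm_num)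
  have h5 := div_le_div_of_nonneg_right h1 (mul_pos ha hb).le
  linarith

end HexagonFree

/-! ### Bipartite cube-free bound. -/

section Cube

open scoped Classical

variable {α β : Type*} {R : α → β → Prop} {X : Finset α} {Y : Finset β}

/-- Both sides count walks `x u v y`, by end pair and by middle edge. -/
theorem sum_card_interedges_neighbors (R : α → β → Prop) (X : Finset α) (Y : Finset β) :
    ∑ q ∈ X ×ˢ Y, #(Rel.interedges R {v ∈ X | R v q.2} {u ∈ Y | R q.1 u}) =
      ∑ p ∈ Rel.interedges R X Y, #{y ∈ Y | R p.1 y} * #{x ∈ X | R x p.2} := by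
  calc _ = ∑ q ∈ X ×ˢ Y, #{p ∈ Rel.interedges R X Y | R q.1 p.2 ∧ R p.1 q.2} := by
        refine sum_congr rfl fun q _ => congrArg card ?_
        ext p
        simp only [Rel.mem_interedges_iff, mem_filter]
        tauto
    _ = ∑ p ∈ Rel.interedges R X Y, #{q ∈ X ×ˢ Y | R q.1 p.2 ∧ R p.1 q.2} := by
        simp only [card_filter]
        exact sum_comm
    _ = _ := by
        refine sum_congr rfl fun p _ => ?_
        rw [mul_comm, ← card_product, ← filter_product]

/-- Deleting `x` and `y` matters only when they are adjacent, and then loses only pairs meeting one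
of them. -/
theorem card_interedges_neighbors_le (R : α → β → Prop) (X : Finset α) (Y : Finset β) (x : α)
    (y : β) :
    #(Rel.interedges R {v ∈ X | R v y} {u ∈ Y | R x u}) ≤
      #(Rel.interedges R {v ∈ X | R v y ∧ v ≠ x} {u ∈ Y | R x u ∧ u ≠ y}) +
        if R x y then #X + #Y else 0 := by
  split_ifs with hxy
  · have hsub : Rel.interedges R {v ∈ X | R v y} {u ∈ Y | R x u} ⊆
        Rel.interedges R {v ∈ X | R v y ∧ v ≠ x} {u ∈ Y | R x u ∧ u ≠ y} ∪
          (X ×ˢ {y} ∪ {x} ×ˢ Y) := by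
      intro p hp
      simp only [Rel.mem_interedges_iff, mem_filter, mem_union, mem_product,
        mem_singleton] at hp ⊢
      tauto
    refine (card_le_card hsub).trans ((card_union_le _ _).trans ?_)
    gcongr
    refine (card_union_le _ _).trans ?_
    simp
  · refine (card_le_card ?_).trans (Nat.le_add_right _ _)
    intro p hp
    simp only [Rel.mem_interedges_iff, mem_filter] at hp ⊢
    refine ⟨⟨hp.1.1, hp.1.2, ?_⟩, ⟨hp.2.1.1, hp.2.1.2, ?_⟩, hp.2.2⟩
    · rintro h
      exact hxy (h ▸ hp.1.2)
    · rintro h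
      exact hxy (h ▸ hp.2.1.2)

/-- The upper bound for the number of walks of length three in a bipartite cube-free graph. -/
theorem three_mul_sum_degree_mul_degree_le
    (h : ∀ x ∈ X, ∀ y ∈ Y,
      HexagonFree R {v ∈ X | R v y ∧ v ≠ x} {u ∈ Y | R x u ∧ u ≠ y})
    {a b : ℝ} (ha : 0 < a) (hb : 0 < b) :
    3 * ∑ p ∈ Rel.interedges R X Y, (#{y ∈ Y | R p.1 y} : ℝ) * #{x ∈ X | R x p.2} ≤
      8 * (#(Rel.interedges R X Y) : ℝ) ^ 2 / (a * b)
        + (a * #X + b * #Y + 9 * (#X + #Y)) * #(Rel.interedges R X Y) := by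
  have hfst : ∑ x ∈ X, (#{y ∈ Y | R x y} : ℝ) = #(Rel.interedges R X Y) := by
    simpa using (sum_interedges_fst R X Y (fun _ => 1)).symm
  have hsnd : ∑ y ∈ Y, (#{x ∈ X | R x y} : ℝ) = #(Rel.interedges R X Y) := by
    simpa using (sum_interedges_snd R X Y (fun _ => 1)).symm
  have hcard : ∑ q ∈ X ×ˢ Y, (if R q.1 q.2 then (#X + #Y : ℝ) else 0) =
      (#X + #Y) * #(Rel.interedges R X Y) := by
    rw [← sum_filter, sum_const, nsmul_eq_mul, mul_comm]
    rfl
  -- Summed over all pairs, the product of degrees gives `e²` and the single degrees give `|X|e` and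
  -- `|Y|e`. The later coefficient 9 is 6 plus 3 from the adjacent pairs.
  have hpt : ∀ q ∈ X ×ˢ Y,
      3 * (#(Rel.interedges R {v ∈ X | R v q.2} {u ∈ Y | R q.1 u}) : ℝ) ≤
        8 * ((#{x ∈ X | R x q.2} : ℝ) * #{y ∈ Y | R q.1 y}) / (a * b)
          + (a + 6) * (#{x ∈ X | R x q.2} : ℝ) + (b + 6) * (#{y ∈ Y | R q.1 y} : ℝ)
          + 3 * (if R q.1 q.2 then (#X + #Y : ℝ) else 0) := by
    intro q hq
    have h1 : (#(Rel.interedges R {v ∈ X | R v q.2} {u ∈ Y | R q.1 u}) : ℝ) ≤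
      #(Rel.interedges R {v ∈ X | R v q.2 ∧ v ≠ q.1} {u ∈ Y | R q.1 u ∧ u ≠ q.2}) +
        if R q.1 q.2 then (#X + #Y : ℝ) else 0 := by
      exact_mod_cast card_interedges_neighbors_le R X Y q.1 q.2
    have h2 := (h q.1 (mem_product.1 hq).1 q.2
      (mem_product.1 hq).2).three_mul_card_interedges_le ha hb
    have hm : (#{v ∈ X | R v q.2 ∧ v ≠ q.1} : ℝ) ≤ #{x ∈ X | R x q.2} := by
      exact_mod_cast card_le_card (monotone_filter_right _ fun _ _ hz => And.left hz)
    have hn : (#{u ∈ Y | R q.1 u ∧ u ≠ q.2} : ℝ) ≤ #{y ∈ Y | R q.1 y} := by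
      exact_mod_cast card_le_card (monotone_filter_right _ fun _ _ hz => And.left hz)
    have h3 : 8 * ((#{v ∈ X | R v q.2 ∧ v ≠ q.1} : ℝ) * #{u ∈ Y | R q.1 u ∧ u ≠ q.2}) / (a * b)
        ≤ 8 * ((#{x ∈ X | R x q.2} : ℝ) * #{y ∈ Y | R q.1 y}) / (a * b) := by gcongr
    have h4 := mul_le_mul_of_nonneg_left hm (by positivity : 0 ≤ a + 6)
    have h5 := mul_le_mul_of_nonneg_left hn (by positivity : 0 ≤ b + 6)
    linarith
  have hsum := sum_le_sum hpt
  have hW : ∑ q ∈ X ×ˢ Y, (#(Rel.interedges R {v ∈ X | R v q.2} {u ∈ Y | R q.1 u}) : ℝ) =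
      ∑ p ∈ Rel.interedges R X Y, (#{y ∈ Y | R p.1 y} : ℝ) * #{x ∈ X | R x p.2} := by
    exact_mod_cast sum_card_interedges_neighbors R X Y
  have hprod : ∑ q ∈ X ×ˢ Y, (#{x ∈ X | R x q.2} : ℝ) * #{y ∈ Y | R q.1 y} =
      (#(Rel.interedges R X Y) : ℝ) ^ 2 := by
    rw [sum_product_right, sq]
    nth_rewrite 1 [← hsnd]
    rw [← hfst, sum_mul_sum]
  have h1 : ∑ q ∈ X ×ˢ Y, (#{x ∈ X | R x q.2} : ℝ) = #X * #(Rel.interedges R X Y) := by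
    rw [sum_product, ← hsnd, ← nsmul_eq_mul]
    exact sum_const (s := X) (∑ y ∈ Y, (#{x ∈ X | R x y} : ℝ))
  have h2 : ∑ q ∈ X ×ˢ Y, (#{y ∈ Y | R q.1 y} : ℝ) = #Y * #(Rel.interedges R X Y) := by
    rw [sum_product_right, ← hfst, ← nsmul_eq_mul]
    exact sum_const (s := Y) (∑ x ∈ X, (#{y ∈ Y | R x y} : ℝ))
  rw [← mul_sum, hW, sum_add_distrib, sum_add_distrib, sum_add_distrib, ← sum_div, ← mul_sum,
    ← mul_sum, ← mul_sum, ← mul_sum, hprod, h1, h2, hcard] at hsum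
  linarith

/-- Here `x` is the positive root of `e² = mt` when `m > 0`, since then `e⁶ = 8em⁴`. If `e > x + y`,
then `mt ≤ ex`, so `e(e - x) ≤ 3s ≤ y²`, which is impossible. -/
theorem le_of_sq_le_mul_add {e t x y m s : ℝ} (he : 0 ≤ e) (hx : 0 ≤ x) (hy : 0 ≤ y)
    (ht : t ^ 3 = 8 * e * m) (hxm : x ^ 5 = 8 * m ^ 4) (hsy : 4 * s ≤ y ^ 2)
    (h : e ^ 2 ≤ m * t + 3 * s) : e ≤ x + y := by
  by_contra! hlt
  have hex : x ≤ e := by linarith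
  have h1 : m * t ≤ e * x := by
    refine le_of_pow_le_pow_left₀ (n := 3) (by norm_num) (by positivity) ?_
    calc (m * t) ^ 3 = e * x ^ 5 := by rw [mul_pow, ht, hxm]; ring
      _ = e * x ^ 2 * x ^ 3 := by ring
      _ ≤ e * e ^ 2 * x ^ 3 := by gcongr
      _ = _ := by ring
  nlinarith [mul_nonneg hx hy]

theorem card_interedges_le_of_forall_hexagonFree
    (h : ∀ x ∈ X, ∀ y ∈ Y,
      HexagonFree R {v ∈ X | R v y ∧ v ≠ x} {u ∈ Y | R x u ∧ u ≠ y}) :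
    (#(Rel.interedges R X Y) : ℝ) ≤
      (2 : ℝ) ^ (3 / 5 : ℝ) * ((#X : ℝ) * #Y) ^ (4 / 5 : ℝ)
        + 2 * (#X : ℝ) * (#Y : ℝ) ^ (1 / 2 : ℝ) + 2 * (#X : ℝ) ^ (1 / 2 : ℝ) * #Y := by
  rcases (Rel.interedges R X Y).eq_empty_or_nonempty with h0 | ⟨p, hp⟩
  · rw [h0, card_empty, Nat.cast_zero]
    positivity
  have hp' := (Rel.mem_interedges_iff).1 hp
  have he : 0 < (#(Rel.interedges R X Y) : ℝ) := by exact_mod_cast card_pos.2 ⟨p, hp⟩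
  have hX : 0 < (#X : ℝ) := by exact_mod_cast card_pos.2 ⟨p.1, hp'.1⟩
  have hY : 0 < (#Y : ℝ) := by exact_mod_cast card_pos.2 ⟨p.2, hp'.2.1⟩
  have hlow := card_interedges_pow_three_le R X Y
  have hup := fun a b ha hb => three_mul_sum_degree_mul_degree_le h (a := a) (b := b) ha hb
  set W := ∑ p ∈ Rel.interedges R X Y, (#{y ∈ Y | R p.1 y} : ℝ) * #{x ∈ X | R x p.2}
  set e : ℝ := (#(Rel.interedges R X Y) : ℝ)
  set a : ℝ := (#X : ℝ)
  set b : ℝ := (#Y : ℝ)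
  -- With parameters `t/|X|` and `t/|Y|`, this `t` makes the three main terms of the upper bound all
  -- equal to `et`.
  obtain ⟨t, ht0, ht⟩ : ∃ t : ℝ, 0 < t ∧ t ^ 3 = 8 * e * (a * b) :=
    ⟨(8 * e * (a * b)) ^ (1 / 3 : ℝ), by positivity, by
      rw [← Real.rpow_natCast, ← Real.rpow_mul (by positivity)]; norm_num⟩
  have hup' := hup (t / a) (t / b) (by positivity) (by positivity)
  have h1 : 8 * e ^ 2 / (t / a * (t / b)) = e * t := by
    rw [div_eq_iff (by positivity)]
    have : e * t * (t / a * (t / b)) = e * t ^ 3 / (a * b) := by field_simp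
    rw [this, ht]
    field_simp
  rw [h1, div_mul_cancel₀ _ hX.ne', div_mul_cancel₀ _ hY.ne'] at hup'
  have hW : W ≤ e * (t + 3 * (a + b)) := by linarith
  have h2 : e ^ 2 ≤ a * b * t + 3 * (a * b * (a + b)) := by
    have := hlow.trans (mul_le_mul_of_nonneg_left hW (by positivity : 0 ≤ a * b))
    refine le_of_mul_le_mul_left ?_ he
    linarith
  rw [add_assoc]
  refine le_of_sq_le_mul_add (m := a * b) (t := t) (s := a * b * (a + b)) he.le (by positivity)
    (by positivity) ht ?_ ?_ h2
  · rw [mul_pow, ← Real.rpow_natCast, ← Real.rpow_natCast, ← Real.rpow_mul (by positivity),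
      ← Real.rpow_mul (by positivity), ← Real.rpow_natCast (a * b) 4]
    norm_num
  · rw [← Real.sqrt_eq_rpow, ← Real.sqrt_eq_rpow]
    have ha := Real.sq_sqrt hX.le
    have hb := Real.sq_sqrt hY.le
    have h3 : (2 * a * √b + 2 * √a * b) ^ 2 =
        4 * a ^ 2 * √b ^ 2 + 4 * √a ^ 2 * b ^ 2 + 8 * a * b * √a * √b := by ring
    rw [h3, ha, hb]
    have : 0 ≤ 8 * a * b * √a * √b := by positivity
    linarith

end Cube

/-! ### From relations to graphs. -/

theorem cubeGraph_isContained_of_hexagon {V : Type*} {G : SimpleGraph V}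
    {x v₁ v₂ v₃ y u₁ u₂ u₃ : V}
    (hne : ∀ p ∈ [x, v₁, v₂, v₃], ∀ q ∈ [y, u₁, u₂, u₃], p ≠ q)
    (hv : [x, v₁, v₂, v₃].Nodup) (hu : [y, u₁, u₂, u₃].Nodup)
    (hx₁ : G.Adj x u₁) (hx₂ : G.Adj x u₂) (hx₃ : G.Adj x u₃)
    (hy₁ : G.Adj v₁ y) (hy₂ : G.Adj v₂ y) (hy₃ : G.Adj v₃ y)
    (h₁₂ : G.Adj v₁ u₂) (h₁₃ : G.Adj v₁ u₃) (h₂₁ : G.Adj v₂ u₁) (h₂₃ : G.Adj v₂ u₃)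
    (h₃₁ : G.Adj v₃ u₁) (h₃₂ : G.Adj v₃ u₂) : cubeGraph.IsContained G := by
  -- `x` and `y` are antipodal, as are `uᵢ` and `vᵢ`; the other six vertices form the hexagon.
  let f : Bool → Bool → Bool → V := fun
    | false, false, false => x
    | true, false, false => u₁
    | false, true, false => u₂
    | false, false, true => u₃
    | false, true, true => v₁
    | true, false, true => v₂
    | true, true, false => v₃
    | true, true, true => y
  have hadj : ∀ a b c a' b' c', hammingDist ![a, b, c] ![a', b', c'] = 1 →
      G.Adj (f a b c) (f a' b' c') := by
    rintro (_ | _) (_ | _) (_ | _) (_ | _) (_ | _) (_ | _) h <;>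
      first
      | exact absurd h (by decide)
      | assumption
      | (apply SimpleGraph.Adj.symm; assumption)
  have hinj : ∀ a b c a' b' c', f a b c = f a' b' c' → ![a, b, c] = ![a', b', c'] := by
    simp only [List.mem_cons, List.not_mem_nil, or_false, forall_eq_or_imp, forall_eq] at hne
    simp only [List.nodup_cons, List.mem_cons, List.not_mem_nil, or_false, not_or,
      not_false_eq_true, List.nodup_nil, and_true] at hv hu
    rintro (_ | _) (_ | _) (_ | _) (_ | _) (_ | _) (_ | _) h <;>
      first
      | rfl
      | (exfalso; simp only [f] at h; grind)
  have hvec (c : Fin 3 → Bool) : ![c 0, c 1, c 2] = c := by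
    ext i; fin_cases i <;> rfl
  refine ⟨⟨⟨fun c => f (c 0) (c 1) (c 2), fun {c d} h => ?_⟩, fun c d h => ?_⟩⟩
  · refine hadj _ _ _ _ _ _ ?_
    rw [hvec, hvec]
    exact h
  · rw [← hvec c, ← hvec d]
    exact hinj _ _ _ _ _ _ h

theorem card_edgeFinset_le_of_isBipartiteWith {V : Type*} [Fintype V] (G : SimpleGraph V)
    [DecidableRel G.Adj] (A B : Finset V) (hAB : G.IsBipartiteWith (A : Set V) (B : Set V))
    (hfree : cubeGraph.Free G) :
    (G.edgeFinset.card : ℝ) ≤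
      (2 : ℝ) ^ (3 / 5 : ℝ) * ((A.card : ℝ) * (B.card : ℝ)) ^ (4 / 5 : ℝ)
        + 2 * (A.card : ℝ) * (B.card : ℝ) ^ (1 / 2 : ℝ)
        + 2 * (A.card : ℝ) ^ (1 / 2 : ℝ) * (B.card : ℝ) := by
  classical
  have hdisj : ∀ p ∈ A, ∀ q ∈ B, p ≠ q := fun p hp q hq hpq =>
    Finset.disjoint_left.1 (Finset.disjoint_coe.1 hAB.disjoint) hp (hpq ▸ hq)
  have hE : #G.edgeFinset = #(Rel.interedges G.Adj A B) := by
    rw [← SimpleGraph.isBipartiteWith_sum_degrees_eq_card_edges hAB, Rel.interedges, card_filter,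
      sum_product]
    refine sum_congr rfl fun v hv => ?_
    rw [← SimpleGraph.card_neighborFinset_eq_degree,
      SimpleGraph.isBipartiteWith_neighborFinset hAB hv, card_filter]
  have key := card_interedges_le_of_forall_hexagonFree (R := G.Adj) (X := A) (Y := B) (by
    intro x hx y hy v₁ hv₁ v₂ hv₂ v₃ hv₃ u₁ hu₁ u₂ hu₂ u₃ hu₃ n₁ n₂ n₃ n₄ n₅ n₆ h₁ h₂ h₃ h₄ h₅ h₆
    simp only [mem_filter] at hv₁ hv₂ hv₃ hu₁ hu₂ hu₃
    refine hfree (cubeGraph_isContained_of_hexagon (x := x) (y := y) ?_ ?_ ?_ hu₁.2.1 hu₂.2.1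
      hu₃.2.1 hv₁.2.1 hv₂.2.1 hv₃.2.1 h₁ h₂ h₃ h₄ h₅ h₆)
    · intro p hp q hq
      refine hdisj p ?_ q ?_
      · simp only [List.mem_cons, List.not_mem_nil, or_false] at hp
        rcases hp with rfl | rfl | rfl | rfl <;> tauto
      · simp only [List.mem_cons, List.not_mem_nil, or_false] at hq
        rcases hq with rfl | rfl | rfl | rfl <;> tauto
    · simp [n₁, n₂, n₃, hv₁.2.2.symm, hv₂.2.2.symm, hv₃.2.2.symm]
    · simp [n₄, n₅, n₆, hu₁.2.2.symm, hu₂.2.2.symm, hu₃.2.2.symm])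
  rw [hE]
  convert key

/-! ### Large cuts and the general bound. -/

theorem two_mul_card_filter_separates {V : Type*} [Fintype V] [DecidableEq V] {u v : V}
    (huv : u ≠ v) :
    2 * #{A : Finset V | (u ∈ A ∧ v ∉ A) ∨ (u ∉ A ∧ v ∈ A)} = #(univ : Finset (Finset V)) := by
  -- Toggling membership of `u` exchanges separating and non-separating sets.
  have hswap : #{A : Finset V | (u ∈ A ∧ v ∉ A) ∨ (u ∉ A ∧ v ∈ A)} =
      #{A : Finset V | ¬((u ∈ A ∧ v ∉ A) ∨ (u ∉ A ∧ v ∈ A))} := by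
    refine card_bij' (fun A _ => symmDiff A {u}) (fun A _ => symmDiff A {u}) ?_ ?_ ?_ ?_
    · intro A hA
      simp only [mem_filter, mem_univ, true_and, mem_symmDiff, mem_singleton] at hA ⊢
      grind
    · intro A hA
      simp only [mem_filter, mem_univ, true_and, mem_symmDiff, mem_singleton] at hA ⊢
      grind
    · intro A _; exact symmDiff_symmDiff_cancel_right _ _
    · intro A _; exact symmDiff_symmDiff_cancel_right _ _
  rw [← card_filter_add_card_filter_not (s := univ)
    (fun A : Finset V => (u ∈ A ∧ v ∉ A) ∨ (u ∉ A ∧ v ∈ A)), ← hswap, two_mul]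

theorem card_filter_adj {V : Type*} [Fintype V] (G : SimpleGraph V) [DecidableRel G.Adj] :
    #{p : V × V | G.Adj p.1 p.2} = 2 * #G.edgeFinset := by
  rw [← SimpleGraph.sum_degrees_eq_twice_card_edges, card_filter, ← univ_product_univ,
    sum_product]
  refine sum_congr rfl fun v _ => ?_
  rw [← SimpleGraph.card_neighborFinset_eq_degree, SimpleGraph.neighborFinset_eq_filter,
    card_filter]

open scoped Classical in
/-- Every graph has a cut containing at least half of its edges. -/
theorem exists_card_edgeFinset_le_two_mul_card_between {V : Type*} [Fintype V]
    (G : SimpleGraph V) [DecidableRel G.Adj] :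
    ∃ A : Finset V, #G.edgeFinset ≤ 2 * #(G.between (A : Set V) (A : Set V)ᶜ).edgeFinset := by
  by_contra! hlt
  have hsep (A : Finset V) : 2 * #(G.between (A : Set V) (A : Set V)ᶜ).edgeFinset =
      #{p ∈ ({p : V × V | G.Adj p.1 p.2} : Finset (V × V)) |
        (p.1 ∈ A ∧ p.2 ∉ A) ∨ (p.1 ∉ A ∧ p.2 ∈ A)} := by
    rw [← card_filter_adj, filter_filter]
    simp [SimpleGraph.between_adj]
  -- Averaging over all `A`: each edge is cut by exactly half of the vertex sets.
  have hsum : ∑ A : Finset V, 2 * (2 * #(G.between (A : Set V) (A : Set V)ᶜ).edgeFinset) =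
      ∑ A : Finset V, 2 * #G.edgeFinset := by
    calc _ = ∑ p : V × V with G.Adj p.1 p.2,
          2 * #{A : Finset V | (p.1 ∈ A ∧ p.2 ∉ A) ∨ (p.1 ∉ A ∧ p.2 ∈ A)} := by
          simp only [hsep]
          rw [← mul_sum, ← mul_sum]
          simp only [card_filter]
          rw [sum_comm]
      _ = ∑ p : V × V with G.Adj p.1 p.2, #(univ : Finset (Finset V)) := by
          refine sum_congr rfl fun p hp => two_mul_card_filter_separates ?_
          exact ((mem_filter.1 hp).2 : G.Adj _ _).ne
      _ = _ := by rw [sum_const, sum_const, ← card_filter_adj, smul_eq_mul, smul_eq_mul, mul_comm]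
  refine hsum.not_lt (sum_lt_sum_of_nonempty univ_nonempty fun A _ => ?_)
  exact Nat.mul_lt_mul_of_pos_left (hlt A) two_pos

/-- Both terms are largest at `a = b = n/2`; the second factors as `4√(ab)(√a + √b)`. -/
theorem bipartite_bound_le {a b n : ℝ} (ha : 0 ≤ a) (hb : 0 ≤ b) (hn : a + b = n) :
    2 * ((2 : ℝ) ^ (3 / 5 : ℝ) * (a * b) ^ (4 / 5 : ℝ) + 2 * a * b ^ (1 / 2 : ℝ)
      + 2 * a ^ (1 / 2 : ℝ) * b) ≤ n ^ (8 / 5 : ℝ) + (2 * n) ^ (3 / 2 : ℝ) := by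
  have hn0 : 0 ≤ n := hn ▸ add_nonneg ha hb
  have hab : a * b ≤ (n / 2) ^ 2 := by rw [← hn]; nlinarith [sq_nonneg (a - b)]
  have h1 : 2 * ((2 : ℝ) ^ (3 / 5 : ℝ) * (a * b) ^ (4 / 5 : ℝ)) ≤ n ^ (8 / 5 : ℝ) := by
    calc _ ≤ 2 * ((2 : ℝ) ^ (3 / 5 : ℝ) * ((n / 2) ^ 2) ^ (4 / 5 : ℝ)) := by gcongr
      _ = n ^ (8 / 5 : ℝ) := by
        rw [← Real.rpow_natCast, ← Real.rpow_mul (by positivity), Real.div_rpow hn0 two_pos.le]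
        have : (2 : ℝ) * 2 ^ (3 / 5 : ℝ) = 2 ^ (8 / 5 : ℝ) := by
          rw [← Real.rpow_one_add' two_pos.le (by norm_num)]
          norm_num
        rw [← mul_assoc, this, show ((2 : ℕ) : ℝ) * (4 / 5) = 8 / 5 by norm_num]
        field_simp
  have h2 : 2 * (2 * a * b ^ (1 / 2 : ℝ) + 2 * a ^ (1 / 2 : ℝ) * b) ≤ (2 * n) ^ (3 / 2 : ℝ) := by
    rw [← Real.sqrt_eq_rpow, ← Real.sqrt_eq_rpow, show (3 / 2 : ℝ) = 1 + 1 / 2 by norm_num,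
      Real.rpow_one_add' (by positivity) (by norm_num), ← Real.sqrt_eq_rpow]
    have hs : √a * √b ≤ n / 2 := by
      rw [← Real.sqrt_mul ha]
      exact Real.sqrt_le_iff.2 ⟨by positivity, hab⟩
    have ht : √a + √b ≤ √(2 * n) := by
      refine Real.le_sqrt_of_sq_le ?_
      rw [← hn]
      nlinarith [Real.sq_sqrt ha, Real.sq_sqrt hb, sq_nonneg (√a - √b)]
    calc 2 * (2 * a * √b + 2 * √a * b) = 4 * (√a ^ 2 * √b + √a * √b ^ 2) := by
          rw [Real.sq_sqrt ha, Real.sq_sqrt hb]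
          ring
      _ = 4 * ((√a * √b) * (√a + √b)) := by ring
      _ ≤ 4 * (n / 2 * √(2 * n)) := by gcongr
      _ = _ := by ring
  linarith

theorem card_edgeFinset_le_of_cubeGraph_free {V : Type*} [Fintype V] (G : SimpleGraph V)
    [DecidableRel G.Adj] (hfree : cubeGraph.Free G) :
    (G.edgeFinset.card : ℝ) ≤
      (Fintype.card V : ℝ) ^ (8 / 5 : ℝ) + (2 * (Fintype.card V : ℝ)) ^ (3 / 2 : ℝ) := by
  classical
  obtain ⟨A, hA⟩ := exists_card_edgeFinset_le_two_mul_card_between G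
  have hbip : (G.between (A : Set V) (A : Set V)ᶜ).IsBipartiteWith (A : Set V)
      ((Aᶜ : Finset V) : Set V) := by
    rw [coe_compl]
    exact SimpleGraph.between_isBipartiteWith disjoint_compl_right
  have hfree' : cubeGraph.Free (G.between (A : Set V) (A : Set V)ᶜ) := fun h =>
    hfree (h.trans (SimpleGraph.IsContained.of_le SimpleGraph.between_le))
  have key := card_edgeFinset_le_of_isBipartiteWith _ A Aᶜ hbip hfree'
  have hcard : (#A : ℝ) + #Aᶜ = Fintype.card V := by exact_mod_cast card_add_card_compl A
  have hA' : (#G.edgeFinset : ℝ) ≤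
      2 * #(G.between (A : Set V) (A : Set V)ᶜ).edgeFinset := by
    exact_mod_cast hA
  refine le_trans (hA'.trans ?_)
    (bipartite_bound_le (Nat.cast_nonneg #A) (Nat.cast_nonneg #Aᶜ) hcard)
  linarith

theorem extremalNumber_cubeGraph_le (n : ℕ) :
    (SimpleGraph.extremalNumber n cubeGraph : ℝ) ≤
      (n : ℝ) ^ (8 / 5 : ℝ) + (2 * (n : ℝ)) ^ (3 / 2 : ℝ) := by
  have h := (SimpleGraph.extremalNumber_le_iff_of_nonneg (V := Fin n) cubeGraph
    (m := (n : ℝ) ^ (8 / 5 : ℝ) + (2 * (n : ℝ)) ^ (3 / 2 : ℝ)) (by positivity)).2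
    fun G _ hG => by simpa using card_edgeFinset_le_of_cubeGraph_free G hG
  rwa [Fintype.card_fin] at h

theorem extremalNumber_cubeGraph_isBigO :
    (fun n : ℕ => (SimpleGraph.extremalNumber n cubeGraph : ℝ))
      =O[Filter.atTop] (fun n : ℕ => (n : ℝ) ^ (8 / 5 : ℝ)) := by
  refine Asymptotics.IsBigO.of_bound (1 + 2 ^ (3 / 2 : ℝ)) ?_
  filter_upwards [Filter.eventually_ge_atTop 1] with n hn
  have hn' : (1 : ℝ) ≤ n := by exact_mod_cast hn
  rw [Real.norm_of_nonneg (by positivity), Real.norm_of_nonneg (by positivity)]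
  refine (extremalNumber_cubeGraph_le n).trans ?_
  rw [Real.mul_rpow two_pos.le (by positivity), one_add_mul]
  have : (n : ℝ) ^ (3 / 2 : ℝ) ≤ (n : ℝ) ^ (8 / 5 : ℝ) :=
    Real.rpow_le_rpow_of_exponent_le hn' (by norm_num)
  gcongr

end

theorem theorem7 :
    -- every `n`-vertex cube-free graph has at most `n ^ (8/5) + (2n) ^ (3/2)` edges
    (∀ (V : Type*) [Fintype V] (G : SimpleGraph V) [DecidableRel G.Adj],
      cubeGraph.Free G →
        (G.edgeFinset.card : ℝ) ≤
          (Fintype.card V : ℝ) ^ (8 / 5 : ℝ) + (2 * (Fintype.card V : ℝ)) ^ (3 / 2 : ℝ)) ∧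
    -- in terms of the Turán number: the explicit bound and the order of magnitude
    (∀ n : ℕ, (SimpleGraph.extremalNumber n cubeGraph : ℝ) ≤
        (n : ℝ) ^ (8 / 5 : ℝ) + (2 * (n : ℝ)) ^ (3 / 2 : ℝ)) ∧
    (fun n : ℕ => (SimpleGraph.extremalNumber n cubeGraph : ℝ))
        =O[Filter.atTop] (fun n : ℕ => (n : ℝ) ^ (8 / 5 : ℝ)) ∧
    -- the bipartite version
    (∀ (V : Type*) [Fintype V] (G : SimpleGraph V) [DecidableRel G.Adj] (A B : Finset V),
      G.IsBipartiteWith (A : Set V) (B : Set V) →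
      cubeGraph.Free G →
        (G.edgeFinset.card : ℝ) ≤
          (2 : ℝ) ^ (3 / 5 : ℝ) * ((A.card : ℝ) * (B.card : ℝ)) ^ (4 / 5 : ℝ)
            + 2 * (A.card : ℝ) * (B.card : ℝ) ^ (1 / 2 : ℝ)
            + 2 * (A.card : ℝ) ^ (1 / 2 : ℝ) * (B.card : ℝ)) := by
  exact ⟨fun V _ G _ h => card_edgeFinset_le_of_cubeGraph_free G h, extremalNumber_cubeGraph_le,
    extremalNumber_cubeGraph_isBigO,
    fun V _ G _ A B hAB h => card_edgeFinset_le_of_isBipartiteWith G A B hAB h⟩
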